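/- Notation. For an abelian group $A$, $\Gamma(A)$ denotes Whitehead's quadratic functor: the abelian group with generators $v(a)$, $a\in A$, and relations $v(-a)=v(a)$ and $v(a+b+c)-v(a+b)-v(b+c)-v(c+a)+v(a)+v(b)+v(c)=0$ for $a,b,c\in A$. If $A$ is a left $\mathbb{Z}\pi$-module for a group $\pi$, then so is $\Gamma(A)$, with $g\cdot v(a)=v(ga)$. For a homomorphism $w\colon\pi\to\{\pm1\}$, $\mathbb{Z}^w$ denotes $\mathbb{Z}$ with $g\in\pi$ acting as multiplication by $w(g)$ (as a right module: $z\cdot g=w(g)z$), and $\mathrm{Tors}$ denotes the torsion subgroup of an abelian group. A Poincaré 4-complex $(X,w)$ is a path-connected space $X$ dominated by a finite CW complex, with fundamental group $\pi$ and a homomorphism $w\colon\pi\to\{\pm1\}$ (the orientation character), for which there is a class $[X]\in H_4(X;\mathbb{Z}^w)$ such that cap product with $[X]$ induces isomorphisms $H^k(X;\mathbb{Z}\pi)\to H_{4-k}(X;\mathbb{Z}\pi)$ for all $k\in\mathbb{Z}$, where the homology groups are formed with the coefficients $\mathbb{Z}\pi$ twisted by $w$. Proposition 1.6. (i) Let $(X,w)$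 be a Poincaré 4-complex with fundamental group $\pi$. Suppose that the $\mathbb{Z}\pi$-module $\pi_2(X)$ splits off a non-zero free module, that is, $\pi_2(X)=F\oplus N$ for $\mathbb{Z}\pi$-submodules $F,N$ with $F$ free and $F\neq0$, and that there is an element $g\in\pi$ with $g^2=1$ and $w(g)=-1$. Then $$\mathrm{Tors}\bigl(\mathbb{Z}^w\otimes_{\mathbb{Z}\pi}\Gamma(\pi_2(X))\bigr)\neq0.$$ (ii) For every group $\pi$ and every homomorphism $w\colon\pi\to\{\pm1\}$ there is an isomorphism of abelian groups $$\mathrm{Tors}\bigl(\mathbb{Z}^w\otimes_{\mathbb{Z}\pi}\Gamma(\mathbb{Z}\pi)\bigr)\cong\bigoplus_{g\in\pi,\ g^2=1,\ w(g)=-1}\mathbb{Z}/2;$$ in particular, this is $(\mathbb{Z}/2)^r$ if the number $r$ of elements $g\in\pi$ with $g^2=1$ and $w(g)=-1$ is finite. -/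

import Mathlib

noncomputable section

open scoped unitInterval Topology Topology.Homotopy

namespace PiTwoAction

variable {X : Type*} [TopologicalSpace X] {x : X}

/-- The distance of a point of the square from its centre in the maximum norm, scaled so that the
boundary of the square is at distance `1`. -/
def radius (t : I^ (Fin 2)) : ℝ := ‖fun i => 2 * (t i : ℝ) - 1‖

theorem continuous_radius : Continuous radius := by
  unfold radius; fun_prop

theorem radius_le_one (t : I^ (Fin 2)) : radius t ≤ 1 := by
  unfold radius
  rw [pi_norm_le_iff_of_nonneg zero_le_one]
  intro i
  rw [Real.norm_eq_abs, abs_le]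
  have := (t i).2.1
  have := (t i).2.2
  constructor <;> linarith

theorem radius_boundary {t : I^ (Fin 2)} (ht : t ∈ Cube.boundary (Fin 2)) : radius t = 1 := by
  refine le_antisymm (radius_le_one t) ?_
  obtain ⟨i, hi⟩ := ht
  have h := norm_le_pi_norm (fun i => 2 * (t i : ℝ) - 1) i
  refine le_trans ?_ h
  rcases hi with hi | hi <;> norm_num [hi]

/-- The dilation of the square from its centre by the factor `1 / ρ`, clamped to the square. -/
def dilate (ρ : ℝ) (t : I^ (Fin 2)) : I^ (Fin 2) := fun i =>
  Set.projIcc 0 1 zero_le_one (1 / 2 + ((t i : ℝ) - 1 / 2) / ρ)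

theorem dilate_one (t : I^ (Fin 2)) : dilate 1 t = t := by
  funext i
  have : (1 / 2 + ((t i : ℝ) - 1 / 2) / 1) = t i := by ring
  simp only [dilate, this, Set.projIcc_val]

theorem dilate_mem_boundary {ρ : ℝ} (hρ : 0 < ρ) {t : I^ (Fin 2)} (h : radius t = ρ) :
    dilate ρ t ∈ Cube.boundary (Fin 2) := by
  by_contra hc
  have key : radius t < ρ := by
    unfold radius
    rw [pi_norm_lt_iff hρ]
    intro i
    rw [Real.norm_eq_abs]
    by_contra hi
    rw [not_lt, le_abs] at hi
    apply hc
    refine ⟨i, ?_⟩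
    rcases hi with hi | hi
    · right
      apply Set.projIcc_of_right_le
      have : 1 / 2 ≤ ((t i : ℝ) - 1 / 2) / ρ := by rw [le_div_iff₀ hρ]; linarith
      linarith
    · left
      apply Set.projIcc_of_le_left
      have : ((t i : ℝ) - 1 / 2) / ρ ≤ - (1 / 2) := by rw [div_le_iff₀ hρ]; linarith
      linarith
  linarith

/-- The map on the square that is `F`, shrunk to the concentric square of radius `ρ`, and on the
rest of the square depends through `Q` only on the distance from the centre. -/
def glue (F : (I^ (Fin 2)) → X) (Q : ℝ → X) (ρ : ℝ) (t : I^ (Fin 2)) : X :=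
  if radius t ≤ ρ then F (dilate ρ t) else Q (radius t)

theorem continuous_glue {S : Type*} [TopologicalSpace S] {F : S → (I^ (Fin 2)) → X}
    {Q : S → ℝ → X} {ρ : S → ℝ} (hF : Continuous fun p : S × (I^ (Fin 2)) => F p.1 p.2)
    (hQ : Continuous fun p : S × ℝ => Q p.1 p.2) (hρ : Continuous ρ) (hpos : ∀ s, 0 < ρ s)
    (h : ∀ s, ∀ y ∈ Cube.boundary (Fin 2), F s y = Q s (ρ s)) :
    Continuous fun p : S × (I^ (Fin 2)) => glue (F p.1) (Q p.1) (ρ p.1) p.2 := by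
  have hd : Continuous fun p : S × (I^ (Fin 2)) => dilate (ρ p.1) p.2 := by
    refine continuous_pi fun i => continuous_projIcc.comp ?_
    refine continuous_const.add (Continuous.div (by fun_prop) (by fun_prop) ?_)
    exact fun p => (hpos p.1).ne'
  have hr : Continuous fun p : S × (I^ (Fin 2)) => radius p.2 :=
    continuous_radius.comp continuous_snd
  refine Continuous.if_le (hF.comp (continuous_fst.prodMk hd)) (hQ.comp (continuous_fst.prodMk hr))
    hr (hρ.comp continuous_fst) ?_
  intro p hp
  rw [h _ _ (dilate_mem_boundary (hpos p.1) hp), hp]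

/-- Transport of a map `(I², ∂I²) → (X, x)` along a loop `P`: a small concentric copy of `f`,
surrounded by a collar on which the map runs through `P` from the inside to the outside. -/
def transport (P : Path x x) (f : Ω^ (Fin 2) X x) : Ω^ (Fin 2) X x :=
  ⟨⟨fun t => glue f (fun r => P.extend (2 * r - 1)) (1 / 2) t, by
    have := continuous_glue (S := Unit) (F := fun _ => f)
      (Q := fun _ r => P.extend (2 * r - 1)) (ρ := fun _ => 1 / 2)
      (by fun_prop) (by fun_prop) (by fun_prop) (by simp)
      (by intro _ y hy; simpa using GenLoop.boundary f y hy)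
    exact this.comp (continuous_const (y := ()) |>.prodMk continuous_id)⟩, by
    intro y hy
    change glue f (fun r => P.extend (2 * r - 1)) (1 / 2) y = x
    rw [glue, radius_boundary hy, if_neg (by norm_num)]
    norm_num⟩

theorem transport_apply (P : Path x x) (f : Ω^ (Fin 2) X x) (t : I^ (Fin 2)) :
    transport P f t = glue f (fun r => P.extend (2 * r - 1)) (1 / 2) t := rfl

theorem homotopic_of {f g : Ω^ (Fin 2) X x} (K : I → (I^ (Fin 2)) → X)
    (hK : Continuous fun p : I × (I^ (Fin 2)) => K p.1 p.2) (h0 : ∀ t, K 0 t = f t)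
    (h1 : ∀ t, K 1 t = g t) (hb : ∀ s, ∀ y ∈ Cube.boundary (Fin 2), K s y = x) :
    GenLoop.Homotopic f g :=
  ⟨⟨⟨⟨fun p => K p.1 p.2, hK⟩, h0, h1⟩, fun s y hy => (hb s y hy).trans (f.2 y hy).symm⟩⟩

/-- `g` is obtained from `f` by a homotopy under which the boundary of the square runs
through the loop `P`. -/
def FreelyHomotopic (P : Path x x) (f g : Ω^ (Fin 2) X x) : Prop :=
  ∃ H : C(I × (I^ (Fin 2)), X), (∀ t, H (0, t) = f t) ∧ (∀ t, H (1, t) = g t) ∧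
    ∀ s, ∀ y ∈ Cube.boundary (Fin 2), H (s, y) = P s

theorem freelyHomotopic_transport (P : Path x x) (f : Ω^ (Fin 2) X x) :
    FreelyHomotopic P f (transport P f) := by
  refine ⟨⟨fun p => glue f (fun r => P.extend (2 * (r - (1 - (p.1 : ℝ) / 2))))
    (1 - (p.1 : ℝ) / 2) p.2, ?_⟩, ?_, ?_, ?_⟩
  · refine continuous_glue (S := I) (F := fun _ => f)
      (Q := fun s r => P.extend (2 * (r - (1 - (s : ℝ) / 2)))) (ρ := fun s => 1 - (s : ℝ) / 2)
      (by fun_prop) (by fun_prop) (by fun_prop) ?_ ?_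
    · intro s; have := s.2.2; linarith
    · intro s y hy; simpa using GenLoop.boundary f y hy
  · intro t
    simp only [ContinuousMap.coe_mk, glue]
    rw [if_pos (by simpa using radius_le_one t)]
    simp [dilate_one]
  · intro t
    simp only [ContinuousMap.coe_mk, transport_apply]
    norm_num
    congr 1
    funext r
    congr 1
    ring
  · intro s y hy
    simp only [ContinuousMap.coe_mk, glue, radius_boundary hy]
    split_ifs with h
    · have hs : (s : ℝ) = 0 := le_antisymm (by linarith) s.2.1
      have hs' : s = 0 := Subtype.ext hs
      subst hs'
      simpa [dilate_one] using GenLoop.boundary f y hy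
    · have : (2 * (1 - (1 - (s : ℝ) / 2))) = s := by ring
      rw [this, Path.extend_apply _ s.2]

theorem FreelyHomotopic.transport_homotopic {P : Path x x} {f g : Ω^ (Fin 2) X x}
    (h : FreelyHomotopic P f g) : GenLoop.Homotopic (transport P f) g := by
  obtain ⟨H, H0, H1, Hb⟩ := h
  refine homotopic_of (fun s t => glue (fun t => H (s, t)) (fun r => P.extend (2 * r - 1))
    ((1 + (s : ℝ)) / 2) t) ?_ ?_ ?_ ?_
  · refine continuous_glue (S := I) (F := fun s t => H (s, t))
      (Q := fun _ r => P.extend (2 * r - 1)) (ρ := fun s => (1 + (s : ℝ)) / 2)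
      (by fun_prop) (by fun_prop) (by fun_prop) ?_ ?_
    · intro s; have := s.2.1; linarith
    · intro s y hy
      rw [Hb s y hy]
      have : (2 * ((1 + (s : ℝ)) / 2) - 1) = s := by ring
      simp only [this]
      rw [Path.extend_apply _ s.2]
  · intro t
    change glue (fun t => H (0, t)) (fun r => P.extend (2 * r - 1)) ((1 + ((0 : I) : ℝ)) / 2) t =
      glue f (fun r => P.extend (2 * r - 1)) (1 / 2) t
    simp only [H0, Set.Icc.coe_zero, add_zero]
  · intro t
    rw [glue, if_pos (by simpa using radius_le_one t)]
    norm_num [dilate_one, H1]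
  · intro s y hy
    rw [glue, radius_boundary hy]
    split_ifs with h
    · have hs : (s : ℝ) = 1 := le_antisymm s.2.2 (by linarith)
      have hs' : s = 1 := Subtype.ext hs
      subst hs'
      norm_num [dilate_one, H1]
      exact g.2 y hy
    · norm_num

theorem transport_homotopic_left {P Q : Path x x} (h : P.Homotopic Q) (f : Ω^ (Fin 2) X x) :
    GenLoop.Homotopic (transport P f) (transport Q f) := by
  obtain ⟨H⟩ := h
  refine homotopic_of (fun s t => glue f (fun r => (H.eval s).extend (2 * r - 1)) (1 / 2) t) ?_ ?_ ?_ ?_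
  · refine continuous_glue (S := I) (F := fun _ => f)
      (Q := fun s r => (H.eval s).extend (2 * r - 1)) (ρ := fun _ => 1 / 2)
      (by fun_prop) ?_ (by fun_prop) (by simp) ?_
    · change Continuous fun p : I × ℝ => H (p.1, Set.projIcc 0 1 zero_le_one (2 * p.2 - 1))
      fun_prop
    · intro s y hy; simpa using GenLoop.boundary f y hy
  · intro t
    rw [transport_apply, Path.Homotopy.eval_zero]
  · intro t
    rw [transport_apply, Path.Homotopy.eval_one]
  · intro s y hy
    rw [glue, radius_boundary hy, if_neg (by norm_num)]
    norm_num

theorem transport_homotopic_right (P : Path x x) {f g : Ω^ (Fin 2) X x}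
    (h : GenLoop.Homotopic f g) : GenLoop.Homotopic (transport P f) (transport P g) := by
  obtain ⟨H⟩ := h
  refine homotopic_of (fun s t => glue (fun t => H (s, t)) (fun r => P.extend (2 * r - 1)) (1 / 2) t) ?_ ?_ ?_ ?_
  · refine continuous_glue (S := I) (F := fun s t => H (s, t))
      (Q := fun s r => P.extend (2 * r - 1)) (ρ := fun _ => 1 / 2)
      H.continuous (by fun_prop) (by fun_prop) (by simp) ?_
    · intro s y hy
      have : H (s, y) = f y := H.eq_fst s hy
      simpa [this] using GenLoop.boundary f y hy
  · intro t
    have : (fun t => H (0, t)) = f := funext H.apply_zero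
    rw [this, transport_apply]
  · intro t
    have : (fun t => H (1, t)) = g := funext H.apply_one
    rw [this, transport_apply]
  · intro s y hy
    rw [glue, radius_boundary hy, if_neg (by norm_num)]
    norm_num

theorem freelyHomotopic_refl (f : Ω^ (Fin 2) X x) : FreelyHomotopic (Path.refl x) f f :=
  ⟨⟨fun p => f p.2, by fun_prop⟩, fun _ => rfl, fun _ => rfl, fun _ y hy => f.2 y hy⟩

theorem FreelyHomotopic.trans {P Q : Path x x} {f g h : Ω^ (Fin 2) X x}
    (h₁ : FreelyHomotopic P f g) (h₂ : FreelyHomotopic Q g h) :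
    FreelyHomotopic (P.trans Q) f h := by
  obtain ⟨H, H0, H1, Hb⟩ := h₁
  obtain ⟨K, K0, K1, Kb⟩ := h₂
  let H' : ContinuousMap.Homotopy f.1 g.1 := ⟨H, H0, H1⟩
  let K' : ContinuousMap.Homotopy g.1 h.1 := ⟨K, K0, K1⟩
  refine ⟨(H'.trans K').toContinuousMap, (H'.trans K').apply_zero, (H'.trans K').apply_one, ?_⟩
  intro s y hy
  change (H'.trans K') (s, y) = _
  rw [ContinuousMap.Homotopy.trans_apply, Path.trans_apply]
  split_ifs
  · exact Hb _ y hy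
  · exact Kb _ y hy

theorem transAt_apply (f g : Ω^ (Fin 2) X x) (t : I^ (Fin 2)) :
    GenLoop.transAt 0 f g t = if (t 0 : ℝ) ≤ 1 / 2
      then f (Function.update t 0 <| Set.projIcc 0 1 zero_le_one (2 * t 0))
      else g (Function.update t 0 <| Set.projIcc 0 1 zero_le_one (2 * t 0 - 1)) := rfl

theorem FreelyHomotopic.transAt {P : Path x x} {f g f' g' : Ω^ (Fin 2) X x}
    (h₁ : FreelyHomotopic P f f') (h₂ : FreelyHomotopic P g g') :
    FreelyHomotopic P (GenLoop.transAt 0 f g) (GenLoop.transAt 0 f' g') := by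
  obtain ⟨H, H0, H1, Hb⟩ := h₁
  obtain ⟨K, K0, K1, Kb⟩ := h₂
  refine ⟨⟨fun p => if (p.2 0 : ℝ) ≤ 1 / 2
      then H (p.1, Function.update p.2 0 <| Set.projIcc 0 1 zero_le_one (2 * p.2 0))
      else K (p.1, Function.update p.2 0 <| Set.projIcc 0 1 zero_le_one (2 * p.2 0 - 1)), ?_⟩,
      ?_, ?_, ?_⟩
  · refine Continuous.if_le ?_ ?_ (by fun_prop) (by fun_prop) ?_
    · refine H.continuous.comp (continuous_fst.prodMk ?_)
      exact continuous_snd.update 0 (continuous_projIcc.comp (by fun_prop))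
    · refine K.continuous.comp (continuous_fst.prodMk ?_)
      exact continuous_snd.update 0 (continuous_projIcc.comp (by fun_prop))
    · intro p hp
      rw [Hb _ _ ⟨0, Or.inr ?_⟩, Kb _ _ ⟨0, Or.inl ?_⟩]
      · simp only [Function.update_self, hp]
        exact Set.projIcc_of_le_left _ (by norm_num)
      · simp only [Function.update_self, hp]
        exact Set.projIcc_of_right_le _ (by norm_num)
  · intro t
    simp only [ContinuousMap.coe_mk, transAt_apply, H0, K0]
  · intro t
    simp only [ContinuousMap.coe_mk, transAt_apply, H1, K1]
  · rintro s y ⟨i, hi⟩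
    simp only [ContinuousMap.coe_mk]
    split_ifs with h
    · apply Hb
      refine ⟨i, ?_⟩
      by_cases h0 : i = 0
      · subst h0
        rcases hi with hi | hi
        · left
          simp [hi]
        · rw [hi] at h; norm_num at h
      · simpa [Function.update_of_ne h0] using hi
    · apply Kb
      refine ⟨i, ?_⟩
      by_cases h0 : i = 0
      · subst h0
        rcases hi with hi | hi
        · rw [hi] at h; norm_num at h
        · right
          simp only [Function.update_self, hi]
          exact Set.projIcc_of_right_le _ (by norm_num)
      · simpa [Function.update_of_ne h0] using hi

/-- Transport along a loop, on homotopy classes. -/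
def act (p : FundamentalGroup X x) (a : π_ 2 X x) : π_ 2 X x :=
  Quotient.liftOn₂ p.toPath a (fun P f => (Quotient.mk _ (transport P f) : π_ 2 X x))
    (fun _ _ _ _ hP hf => Quotient.sound
      ((transport_homotopic_left hP _).trans (transport_homotopic_right _ hf)))

/-- The class in `π₂` of a map `(I², ∂I²) → (X, x)`. -/
def cls (f : Ω^ (Fin 2) X x) : π_ 2 X x := Quotient.mk _ f

theorem cls_mul (f g : Ω^ (Fin 2) X x) : cls f * cls g = cls (GenLoop.transAt 0 g f) :=
  HomotopyGroup.mul_spec (i := (0 : Fin 2))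

/-- The action of `π₁` on `π₂`. The product `p * q` in `FundamentalGroup X x` is the class of the loop
that runs through `q` first, so that transport along loops is a left action. -/
instance mulDistribMulAction : MulDistribMulAction (FundamentalGroup X x) (π_ 2 X x) where
  smul := act
  one_smul a := by
    induction a using Quotient.inductionOn with
    | h f => exact Quotient.sound (freelyHomotopic_refl f).transport_homotopic
  mul_smul p q a := by
    induction a using Quotient.inductionOn with
    | h f =>
      induction p using Quotient.inductionOn with
      | h P =>
        induction q using Quotient.inductionOn with
        | h Q =>
          exact Quotient.sound ((freelyHomotopic_transport Q f).trans
            (freelyHomotopic_transport P _)).transport_homotopic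
  smul_mul p a b := by
    induction a using Quotient.inductionOn with
    | h f =>
      induction b using Quotient.inductionOn with
      | h g =>
        induction p using Quotient.inductionOn with
        | h P =>
          have h := (freelyHomotopic_transport P g).transAt (freelyHomotopic_transport P f)
          exact (congrArg (act _) (cls_mul f g)).trans ((Quotient.sound h.transport_homotopic).trans
            (cls_mul (transport P f) (transport P g)).symm)
  smul_one p := by
    induction p using Quotient.inductionOn with
    | h P =>
      refine Quotient.sound (FreelyHomotopic.transport_homotopic ?_)
      exact ⟨⟨fun p => P p.1, by fun_prop⟩, fun _ => P.source, fun _ => P.target,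
        fun _ _ _ => rfl⟩

end PiTwoAction

/-! ### Modules over integral group rings, the twisted integers, the functor `Γ` -/

/-- The `ℤ[G]`-module structure on the underlying group of a representation of `G` over `ℤ`. -/
abbrev Representation.groupRingModule {G A : Type*} [Group G] [AddCommGroup A]
    (ρ : Representation ℤ G A) : Module (MonoidAlgebra ℤ G) A :=
  Module.compHom A ρ.asAlgebraHom.toRingHom

/-- The tensor product `A ⊗[R] B` of a right module `A` and a left module `B` over a ring `R` that
need not be commutative: the tensor product over `ℤ`, modulo `a r ⊗ b = a ⊗ r b`. -/
def BalancedTensor (R A B : Type*) [Ring R] [AddCommGroup A] [Module Rᵐᵒᵖ A] [AddCommGroup B]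
    [Module R B] : Type _ :=
  TensorProduct ℤ A B ⧸ AddSubgroup.closure
    {t | ∃ (a : A) (r : R) (b : B),
      t = TensorProduct.tmul ℤ (MulOpposite.op r • a) b - TensorProduct.tmul ℤ a (r • b)}

namespace BalancedTensor

variable (R : Type*) {A B : Type*} [Ring R] [AddCommGroup A] [Module Rᵐᵒᵖ A] [AddCommGroup B]
  [Module R B]

instance : AddCommGroup (BalancedTensor R A B) :=
  inferInstanceAs (AddCommGroup (TensorProduct ℤ A B ⧸ _))

/-- The pure tensor `a ⊗ b`. -/
def tmul (a : A) (b : B) : BalancedTensor R A B :=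
  QuotientAddGroup.mk (TensorProduct.tmul ℤ a b)

end BalancedTensor

/-- The abelian group `ℤ` on which the group `G` acts through `w : G → {±1}`. -/
def TwistedInt {G : Type*} [Group G] (_w : G →* ℤˣ) : Type := ℤ

namespace TwistedInt

variable {G : Type*} [Group G] (w : G →* ℤˣ)

instance : AddCommGroup (TwistedInt w) := inferInstanceAs (AddCommGroup ℤ)

/-- The element `1` of the twisted integers. -/
def one : TwistedInt w := (1 : ℤ)

/-- The ring homomorphism `ℤ[G] → ℤ` with `g ↦ w g`. -/
def augmentation : MonoidAlgebra ℤ G →ₐ[ℤ] ℤ :=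
  MonoidAlgebra.lift ℤ ℤ G ((Units.coeHom ℤ).comp w)

/-- The right `ℤ[G]`-module structure, `z g = w(g) z`. -/
instance : Module (MonoidAlgebra ℤ G)ᵐᵒᵖ (TwistedInt w) :=
  Module.compHom ℤ ((augmentation w).toRingHom.fromOpposite fun _ _ => Commute.all _ _)

theorem op_of_smul (g : G) (z : TwistedInt w) :
    MulOpposite.op (MonoidAlgebra.of ℤ G g) • z = ((w g : ℤˣ) : ℤ) • z := by
  have h : augmentation w (MonoidAlgebra.of ℤ G g) = ((w g : ℤˣ) : ℤ) := MonoidAlgebra.lift_of _ g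
  change (fun k : ℤ => k • z) (augmentation w (MonoidAlgebra.of ℤ G g)) = _
  rw [h]

end TwistedInt

/-- Whitehead's quadratic functor `Γ`: generators `v a` for `a : A`, relations `v (-a) = v a` and
`v (a + b + c) - v (a + b) - v (b + c) - v (c + a) + v a + v b + v c = 0`. -/
def Gamma (A : Type*) [AddCommGroup A] : Type _ :=
  FreeAbelianGroup A ⧸ AddSubgroup.closure
    ({t | ∃ a : A, t = FreeAbelianGroup.of (-a) - FreeAbelianGroup.of a} ∪
     {t | ∃ a b c : A, t = FreeAbelianGroup.of (a + b + c) - FreeAbelianGroup.of (a + b)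
        - FreeAbelianGroup.of (b + c) - FreeAbelianGroup.of (c + a)
        + FreeAbelianGroup.of a + FreeAbelianGroup.of b + FreeAbelianGroup.of c})

namespace Gamma

variable {A B C : Type*} [AddCommGroup A] [AddCommGroup B] [AddCommGroup C]

instance : AddCommGroup (Gamma A) :=
  inferInstanceAs (AddCommGroup (FreeAbelianGroup A ⧸ _))

/-- The generator `v a`. -/
def v (a : A) : Gamma A := QuotientAddGroup.mk (FreeAbelianGroup.of a)

/-- The homomorphism `Γ(A) → Γ(B)` induced by `f : A → B`, with `v a ↦ v (f a)`. -/
def map (f : A →+ B) : Gamma A →+ Gamma B :=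
  QuotientAddGroup.map _ _ (FreeAbelianGroup.map f) <| by
    rw [AddSubgroup.closure_le]
    rintro t (⟨a, rfl⟩ | ⟨a, b, c, rfl⟩)
    · exact AddSubgroup.subset_closure (Or.inl ⟨f a, by simp⟩)
    · exact AddSubgroup.subset_closure (Or.inr ⟨f a, f b, f c, by simp⟩)

theorem map_v (f : A →+ B) (a : A) : map f (v a) = v (f a) := by
  change QuotientAddGroup.mk (FreeAbelianGroup.map f (FreeAbelianGroup.of a)) = _
  rw [FreeAbelianGroup.map_of_apply]
  rfl

theorem hom_ext {f g : Gamma A →+ B} (h : ∀ a, f (v a) = g (v a)) : f = g :=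
  QuotientAddGroup.addMonoidHom_ext _ (FreeAbelianGroup.lift_ext _ _ h)

theorem map_id : map (AddMonoidHom.id A) = AddMonoidHom.id (Gamma A) :=
  hom_ext fun a => map_v _ a

theorem map_comp (g : B →+ C) (f : A →+ B) : map (g.comp f) = (map g).comp (map f) :=
  hom_ext fun a => by simp only [AddMonoidHom.comp_apply, map_v]

/-- The action of `G` on `Γ(M)`, for a `ℤ[G]`-module `M`: `g • v m = v (g • m)`. -/
def representation (G M : Type*) [Group G] [AddCommGroup M] [Module (MonoidAlgebra ℤ G) M] :
    Representation ℤ G (Gamma M) where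
  toFun g := (map (DistribSMul.toAddMonoidHom M (MonoidAlgebra.of ℤ G g))).toIntLinearMap
  map_one' := by
    have : DistribSMul.toAddMonoidHom M (MonoidAlgebra.of ℤ G 1) = AddMonoidHom.id M := by
      ext a
      rw [map_one]
      exact one_smul _ a
    rw [this, map_id]
    rfl
  map_mul' g h := by
    have : DistribSMul.toAddMonoidHom M (MonoidAlgebra.of ℤ G (g * h)) =
        (DistribSMul.toAddMonoidHom M (MonoidAlgebra.of ℤ G g)).comp
          (DistribSMul.toAddMonoidHom M (MonoidAlgebra.of ℤ G h)) := by
      ext a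
      rw [map_mul]
      exact mul_smul _ _ a
    rw [this, map_comp]
    rfl

instance (G M : Type*) [Group G] [AddCommGroup M] [Module (MonoidAlgebra ℤ G) M] :
    Module (MonoidAlgebra ℤ G) (Gamma M) :=
  (representation G M).groupRingModule

theorem of_smul_v {G M : Type*} [Group G] [AddCommGroup M] [Module (MonoidAlgebra ℤ G) M]
    (g : G) (m : M) :
    MonoidAlgebra.of ℤ G g • (v m : Gamma M) = v (MonoidAlgebra.of ℤ G g • m) := by
  change (representation G M).asAlgebraHom (MonoidAlgebra.single g 1) (v m) = _
  rw [Representation.asAlgebraHom_single, one_smul]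
  exact map_v _ m

end Gamma

/-! ### The second homotopy group as a module over the group ring of the fundamental group -/

/-- `π₂(X, x)`, written additively. -/
def PiTwo (X : Type*) [TopologicalSpace X] (x : X) : Type _ := Additive (π_ 2 X x)

namespace PiTwo

variable (X : Type*) [TopologicalSpace X] (x : X)

instance : AddCommGroup (PiTwo X x) := inferInstanceAs (AddCommGroup (Additive (π_ 2 X x)))

instance : DistribMulAction (FundamentalGroup X x) (PiTwo X x) where
  smul p a := Additive.ofMul (p • (Additive.toMul a : π_ 2 X x))
  one_smul a := one_smul (FundamentalGroup X x) (Additive.toMul a : π_ 2 X x)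
  mul_smul p q a := mul_smul p q (Additive.toMul a : π_ 2 X x)
  smul_zero p := smul_one (N := π_ 2 X x) p
  smul_add p a b := smul_mul' p (Additive.toMul a : π_ 2 X x) (Additive.toMul b : π_ 2 X x)

instance : Module (MonoidAlgebra ℤ (FundamentalGroup X x)) (PiTwo X x) :=
  (Representation.ofDistribMulAction ℤ (FundamentalGroup X x) (PiTwo X x)).groupRingModule

end PiTwo

/-! ### Equivariant singular chains of the universal cover and Poincaré duality -/

section SimplexSegment

variable {ι : Type*} [Fintype ι]

/-- The straight path from `a` to `b` in a standard simplex. -/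
def simplexSegment (a b : stdSimplex ℝ ι) : Path a b where
  toFun t := ⟨(1 - (t : ℝ)) • (a : ι → ℝ) + (t : ℝ) • (b : ι → ℝ),
    convex_stdSimplex ℝ ι a.2 b.2 (by linarith [t.2.2]) t.2.1 (by ring)⟩
  continuous_toFun := by fun_prop
  source' := Subtype.ext (by simp; rfl)
  target' := Subtype.ext (by simp; rfl)

end SimplexSegment

/-- A singular `n`-simplex of the universal cover of `(X, x)`: a singular simplex of `X` with a
homotopy class of paths from its initial vertex to the base point (such classes are the points of
the universal cover over the initial vertex, and a simplex lifts uniquely once its initial vertex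
has been lifted). -/
structure CoverSimplex (X : Type*) [TopologicalSpace X] (x : X) (n : ℕ) where
  /-- the singular simplex of `X` -/
  simplex : C(stdSimplex ℝ (Fin (n + 1)), X)
  /-- the lift of its initial vertex -/
  lift : Path.Homotopic.Quotient (simplex (stdSimplex.vertex 0)) x

namespace CoverSimplex

variable {X : Type*} [TopologicalSpace X] {x : X}

/-- The restriction of a simplex along a map of vertices. The lift of the new initial vertex is
found by running along the image of an edge to the old initial vertex. -/
def restrict {m n : ℕ} (θ : Fin (m + 1) → Fin (n + 1)) (s : CoverSimplex X x n) :
    CoverSimplex X x m where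
  simplex := s.simplex.comp ⟨stdSimplex.map θ, stdSimplex.continuous_map θ⟩
  lift := Path.Homotopic.Quotient.trans
    (Path.Homotopic.Quotient.mk
      ((simplexSegment (stdSimplex.map θ (stdSimplex.vertex 0)) (stdSimplex.vertex 0)).map
        s.simplex.continuous)) s.lift

/-- The deck transformations. -/
instance (n : ℕ) : MulAction (FundamentalGroup X x) (CoverSimplex X x n) where
  smul g s := ⟨s.simplex, s.lift.trans g.toPath⟩
  one_smul s := by
    obtain ⟨f, γ⟩ := s
    change CoverSimplex.mk f (γ.trans _) = _
    congr 1
    exact CategoryTheory.Category.comp_id (X := FundamentalGroupoid.mk _)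
      (Y := FundamentalGroupoid.mk x) γ
  mul_smul g h s := by
    obtain ⟨f, γ⟩ := s
    change CoverSimplex.mk f (γ.trans _) = CoverSimplex.mk f ((γ.trans _).trans _)
    congr 1
    exact (CategoryTheory.Category.assoc (W := FundamentalGroupoid.mk _)
      (X := FundamentalGroupoid.mk x) (Y := FundamentalGroupoid.mk x)
      (Z := FundamentalGroupoid.mk x) γ h g).symm

theorem restrict_smul {m n : ℕ} (θ : Fin (m + 1) → Fin (n + 1)) (g : FundamentalGroup X x)
    (s : CoverSimplex X x n) : restrict θ (g • s) = g • restrict θ s := by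
  obtain ⟨f, γ⟩ := s
  refine congrArg (CoverSimplex.mk (f.comp ⟨stdSimplex.map θ, stdSimplex.continuous_map θ⟩)) ?_
  exact (CategoryTheory.Category.assoc (W := FundamentalGroupoid.mk _)
      (X := FundamentalGroupoid.mk _) (Y := FundamentalGroupoid.mk x)
      (Z := FundamentalGroupoid.mk x) _ γ g).symm

end CoverSimplex

/-- The singular `n`-chains of the universal cover of `(X, x)`. -/
def CoverChain (X : Type*) [TopologicalSpace X] (x : X) (n : ℕ) : Type _ := CoverSimplex X x n →₀ ℤ

namespace CoverChain

variable {X : Type*} [TopologicalSpace X] {x : X}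

instance (n : ℕ) : AddCommGroup (CoverChain X x n) :=
  inferInstanceAs (AddCommGroup (CoverSimplex X x n →₀ ℤ))

/-- The chain that consists of one simplex. -/
def single {n : ℕ} (s : CoverSimplex X x n) : CoverChain X x n := Finsupp.single s 1

/-- The additive extension to chains of a function on simplices. -/
def extend {n : ℕ} {A : Type*} [AddCommGroup A] (f : CoverSimplex X x n → A) :
    CoverChain X x n →+ A :=
  Finsupp.liftAddHom fun s => (zmultiplesHom A) (f s)

theorem extend_single {n : ℕ} {A : Type*} [AddCommGroup A] (f : CoverSimplex X x n → A)
    (s : CoverSimplex X x n) : extend f (single s) = f s := by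
  exact (Finsupp.liftAddHom_apply_single (fun s => (zmultiplesHom A) (f s)) s (1 : ℤ)).trans
    (one_zsmul _)

theorem hom_ext {n : ℕ} {A : Type*} [AddCommGroup A] {f g : CoverChain X x n →+ A}
    (h : ∀ s, f (single s) = g (single s)) : f = g :=
  Finsupp.addHom_ext' fun s => AddMonoidHom.ext_int (h s)

/-- The deck transformation `g` on chains. -/
def deck {n : ℕ} (g : FundamentalGroup X x) : CoverChain X x n →+ CoverChain X x n :=
  extend fun s => single (g • s)

theorem deck_single {n : ℕ} (g : FundamentalGroup X x) (s : CoverSimplex X x n) :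
    deck g (single s) = single (g • s) := extend_single _ s

theorem deck_one {n : ℕ} :
    deck (1 : FundamentalGroup X x) = AddMonoidHom.id (CoverChain X x n) :=
  hom_ext fun s => by rw [deck_single, one_smul, AddMonoidHom.id_apply]

theorem deck_mul {n : ℕ} (g h : FundamentalGroup X x) :
    (deck (g * h) : CoverChain X x n →+ CoverChain X x n) = (deck g).comp (deck h) :=
  hom_ext fun s => by
    rw [deck_single, mul_smul, AddMonoidHom.comp_apply, deck_single, deck_single]

/-- The action of the fundamental group on chains by deck transformations. -/
def representation (X : Type*) [TopologicalSpace X] (x : X) (n : ℕ) :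
    Representation ℤ (FundamentalGroup X x) (CoverChain X x n) where
  toFun g := (deck g).toIntLinearMap
  map_one' := by rw [deck_one]; rfl
  map_mul' g h := by rw [deck_mul]; rfl

instance (n : ℕ) : Module (MonoidAlgebra ℤ (FundamentalGroup X x)) (CoverChain X x n) :=
  (representation X x n).groupRingModule

theorem of_smul_single {n : ℕ} (g : FundamentalGroup X x) (s : CoverSimplex X x n) :
    MonoidAlgebra.of ℤ _ g • single s = single (g • s) := by
  change (representation X x n).asAlgebraHom (MonoidAlgebra.single g 1) (single s) = _
  rw [Representation.asAlgebraHom_single, one_smul]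
  exact deck_single g s

/-- The boundary of a simplex. -/
def simplexBoundary {n : ℕ} (s : CoverSimplex X x (n + 1)) : CoverChain X x n :=
  ∑ i : Fin (n + 2), ((-1 : ℤ) ^ (i : ℕ)) • single (s.restrict i.succAbove)

theorem extend_simplexBoundary_smul {n : ℕ} (r : MonoidAlgebra ℤ (FundamentalGroup X x))
    (c : CoverChain X x (n + 1)) :
    extend simplexBoundary (r • c) = r • extend simplexBoundary c := by
  induction r using MonoidAlgebra.induction_on with
  | of g =>
    have : (extend simplexBoundary).comp
        (DistribSMul.toAddMonoidHom (CoverChain X x (n + 1)) (MonoidAlgebra.of ℤ _ g)) =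
        (DistribSMul.toAddMonoidHom (CoverChain X x n) (MonoidAlgebra.of ℤ _ g)).comp
          (extend simplexBoundary) := by
      refine hom_ext fun s => ?_
      change extend simplexBoundary (MonoidAlgebra.of ℤ _ g • single s) =
        MonoidAlgebra.of ℤ _ g • extend simplexBoundary (single s)
      rw [of_smul_single, extend_single, extend_single, simplexBoundary, simplexBoundary,
        Finset.smul_sum]
      refine Finset.sum_congr rfl fun i _ => ?_
      rw [CoverSimplex.restrict_smul, smul_comm, of_smul_single]
    exact DFunLike.congr_fun this c
  | add a b ha hb => rw [add_smul, map_add, ha, hb, add_smul]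
  | smul k a ha => rw [smul_assoc, map_zsmul, ha, smul_assoc]

/-- The boundary homomorphism of the singular chain complex (zero in degree `0`). -/
def boundary (X : Type*) [TopologicalSpace X] (x : X) : (n : ℕ) →
    CoverChain X x n →ₗ[MonoidAlgebra ℤ (FundamentalGroup X x)] CoverChain X x (n - 1)
  | 0 => 0
  | n + 1 =>
    { toFun := extend (simplexBoundary (n := n))
      map_add' := map_add _
      map_smul' := extend_simplexBoundary_smul }

end CoverChain

/-- The `n`-cochains of `X` with coefficients in `ℤ[π₁]`. -/
abbrev GroupRingCochain (X : Type*) [TopologicalSpace X] (x : X) (n : ℕ) : Type _ :=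
  CoverChain X x n →ₗ[MonoidAlgebra ℤ (FundamentalGroup X x)]
    MonoidAlgebra ℤ (FundamentalGroup X x)

/-- The coboundary of a cochain. -/
def coboundary {X : Type*} [TopologicalSpace X] {x : X} {n : ℕ} (φ : GroupRingCochain X x n) :
    GroupRingCochain X x (n + 1) :=
  φ ∘ₗ CoverChain.boundary X x (n + 1)

section Duality

variable {X : Type*} [TopologicalSpace X] {x : X}

/-- `c` is a cycle. -/
def IsCycle {n : ℕ} (c : CoverChain X x n) : Prop := CoverChain.boundary X x n c = 0

/-- `c` is a boundary. -/
def IsBoundary {n : ℕ} (c : CoverChain X x n) : Prop :=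
  ∃ d : CoverChain X x (n + 1), CoverChain.boundary X x (n + 1) d = c

/-- `φ` is a cocycle. -/
def IsCocycle {n : ℕ} (φ : GroupRingCochain X x n) : Prop := coboundary φ = 0

/-- `φ` is a coboundary (in degree `0`, this means `φ = 0`). -/
def IsCoboundary : {n : ℕ} → GroupRingCochain X x n → Prop
  | 0, φ => φ = 0
  | _ + 1, φ => ∃ ψ, coboundary ψ = φ

/-- The additive involution of `ℤ[G]` with `g ↦ w(g) g⁻¹`. -/
def twistedInvolution {G : Type*} [Group G] (w : G →* ℤˣ) :
    MonoidAlgebra ℤ G →+ MonoidAlgebra ℤ G :=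
  MonoidAlgebra.liftNC (Int.castAddHom (MonoidAlgebra ℤ G))
    fun g => MonoidAlgebra.single g⁻¹ ((w g : ℤˣ) : ℤ)

/-- The cap product `φ ∩ z` of a cochain `φ` with a chain `z`: on a simplex, it is the value of `φ`
on the front face, moved to the left by the involution, times the back face. -/
def cap (w : FundamentalGroup X x →* ℤˣ) {p q n : ℕ} (h : p + q = n) (φ : GroupRingCochain X x p)
    (z : CoverChain X x n) : CoverChain X x q :=
  CoverChain.extend (fun s =>
    twistedInvolution w (φ (CoverChain.single
        (s.restrict (Fin.castLE (by omega : p + 1 ≤ n + 1))))) •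
      CoverChain.single (s.restrict fun i : Fin (q + 1) => (⟨p + i, by omega⟩ : Fin (n + 1)))) z

/-- `X` is dominated by a finite CW complex. -/
def IsFinitelyDominated.{u} (X : Type u) [TopologicalSpace X] : Prop :=
  ∃ (K : Type u) (_ : TopologicalSpace K) (_ : T2Space K)
    (_ : Topology.CWComplex (Set.univ : Set K)),
    Topology.CWComplex.Finite (Set.univ : Set K) ∧
    ∃ (i : C(X, K)) (r : C(K, X)), (r.comp i).Homotopic (ContinuousMap.id X)

/-- The chain `z`, which represents the chain `1 ⊗ z` of `X` with coefficients in `ℤ^w`, is a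
fundamental class for Poincaré duality in dimension `n`: `1 ⊗ z` is a cycle, and the cap product
with `z` induces bijections `H^p(X; ℤ[π₁]) → H_q(X; ℤ[π₁])` for all integers `p + q = n`. -/
structure IsFundamentalClass (w : FundamentalGroup X x →* ℤˣ) (n : ℕ) (z : CoverChain X x n) :
    Prop where
  cycle : BalancedTensor.tmul (MonoidAlgebra ℤ (FundamentalGroup X x)) (TwistedInt.one w)
    (CoverChain.boundary X x n z) = 0
  injective : ∀ (p q : ℕ) (h : p + q = n) (φ : GroupRingCochain X x p), IsCocycle φ →
    IsBoundary (cap w h φ z) → IsCoboundary φ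
  surjective : ∀ (p q : ℕ) (h : p + q = n) (c : CoverChain X x q), IsCycle c →
    ∃ φ : GroupRingCochain X x p, IsCocycle φ ∧ IsBoundary (c - cap w h φ z)
  cohomology_above : ∀ p, n < p → ∀ φ : GroupRingCochain X x p, IsCocycle φ → IsCoboundary φ
  homology_above : ∀ q, n < q → ∀ c : CoverChain X x q, IsCycle c → IsBoundary c

/-- `(X, w)` is a Poincaré complex of formal dimension `n` in the sense of Wall: `X` is connected
and dominated by a finite CW complex, and has a fundamental class in `H_n(X; ℤ^w)`. -/
structure IsPoincareComplex (n : ℕ) (X : Type*) [TopologicalSpace X] (x : X)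
    (w : FundamentalGroup X x →* ℤˣ) : Prop where
  pathConnected : PathConnectedSpace X
  finitelyDominated : IsFinitelyDominated X
  duality : ∃ z : CoverChain X x n, IsFundamentalClass w n z

end Duality

/-- The module `M` splits off a non-zero free module. -/
def SplitsOffFree (R M : Type*) [Ring R] [AddCommGroup M] [Module R M] : Prop :=
  ∃ F N : Submodule R M, IsCompl F N ∧ Module.Free R F ∧ F ≠ ⊥

end

/-! ### Additive and biadditive maps out of the integral group ring -/

namespace MonoidAlgebra

variable {G C : Type*} [AddCommGroup C]

/-! Write `[a, b]` for the polarisation of `v`, and `T` for `ℤ^w ⊗ Γ(ℤ[G])`. Passing to `T`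
identifies a translate by `g` with `w(g)` times the original, so `T` is generated by `1 ⊗ v(1)` and
the classes `1 ⊗ [1, k]` with `k ≠ 1`. Symmetry of the polarisation, followed by translation, gives
`1 ⊗ [1, k⁻¹] = w(k) (1 ⊗ [1, k])`. Thus `k` and `k⁻¹` share one infinite cyclic summand, unless `k²
= 1` and `w(k) = -1`, when the relation reads `2 (1 ⊗ [1, k]) = 0`.

No basis of `Γ(ℤ[G])` is needed, because two kinds of invariants detect everything. The Hermitian
square `1 ⊗ v(a) ↦ ā a` takes values in the torsion-free group `ℤ[G]`, hence kills torsion; by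
`coeff_hermitianSquare_presentation` its vanishing makes the coefficients at `k` and `k⁻¹` cancel,
leaving only odd involutions (`mem_range_of_mem_torsion`). For each odd involution `k`, the
homomorphism `parity` to `ℤ/2` shows that the class of `k` is nonzero and independent of the others
(`parity_involutionClasses`).

For a module with a nonzero free summand, `ℤ[G]` is a retract of it. By functoriality `T` is then a
retract of the corresponding group for the module, so the nonzero 2-torsion class of an odd
involution survives there. -/

/-- The additive extension to `ℤ[G]` of a function on `G`. -/
noncomputable def additiveExtension (f : G → C) : MonoidAlgebra ℤ G →+ C :=
  (Finsupp.liftAddHom fun g => zmultiplesHom C (f g)).comp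
    (MonoidAlgebra.coeffAddEquiv : MonoidAlgebra ℤ G ≃+ (G →₀ ℤ)).toAddMonoidHom

theorem additiveExtension_single (f : G → C) (g : G) (n : ℤ) :
    additiveExtension f (single g n) = n • f g :=
  (Finsupp.liftAddHom_apply_single (fun g => zmultiplesHom C (f g)) g n).trans rfl

theorem additiveExtension_apply (f : G → C) (x : MonoidAlgebra ℤ G) :
    additiveExtension f x = ∑ g ∈ x.coeff.support, x.coeff g • f g :=
  Finsupp.liftAddHom_apply _ _

theorem int_hom_ext {f f' : MonoidAlgebra ℤ G →+ C} (h : ∀ g, f (single g 1) = f' (single g 1)) :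
    f = f' :=
  addHom_ext' fun g => AddMonoidHom.ext_int (h g)

/-- The biadditive extension to `ℤ[G]` of a function on `G × G`. -/
noncomputable def biadditiveExtension (f : G → G → C) :
    MonoidAlgebra ℤ G →+ MonoidAlgebra ℤ G →+ C :=
  additiveExtension fun g => additiveExtension (f g)

theorem biadditiveExtension_single (f : G → G → C) (g h : G) :
    biadditiveExtension f (single g 1) (single h 1) = f g h := by
  rw [biadditiveExtension, additiveExtension_single, one_smul, additiveExtension_single, one_smul]

theorem int_hom_ext₂ {f f' : MonoidAlgebra ℤ G →+ MonoidAlgebra ℤ G →+ C}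
    (h : ∀ g k, f (single g 1) (single k 1) = f' (single g 1) (single k 1)) : f = f' :=
  int_hom_ext fun g => int_hom_ext fun k => h g k

/-- Left multiplication by `x` is additive, so both sides are biadditive in `a` and `b`. This
reduces translation behaviour of a form to pairs of group elements. -/
theorem apply_mul_mul_eq_of_single [Group G] {B B' : MonoidAlgebra ℤ G →+ MonoidAlgebra ℤ G →+ C}
    (x : MonoidAlgebra ℤ G)
    (h : ∀ g k, B (x * single g 1) (x * single k 1) = B' (single g 1) (single k 1))
    (a b : MonoidAlgebra ℤ G) : B (x * a) (x * b) = B' a b := by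
  have key (g : G) (b : MonoidAlgebra ℤ G) : B (x * single g 1) (x * b) = B' (single g 1) b := by
    have : (B (x * single g 1)).comp (AddMonoidHom.mulLeft x) = B' (single g 1) :=
      int_hom_ext fun k => h g k
    exact DFunLike.congr_fun this b
  have : (B.flip (x * b)).comp (AddMonoidHom.mulLeft x) = B'.flip b :=
    int_hom_ext fun g => key g b
  exact DFunLike.congr_fun this a

end MonoidAlgebra

/-! ### Polarisation of `v`, and homomorphisms out of `Γ` -/

namespace Gamma

variable {A C : Type*} [AddCommGroup A] [AddCommGroup C]

theorem v_neg (a : A) : v (-a) = v a := by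
  refine (QuotientAddGroup.eq_iff_sub_mem).2 (AddSubgroup.subset_closure (Or.inl ⟨a, rfl⟩))

theorem v_add_add (a b c : A) :
    v (a + b + c) - v (a + b) - v (b + c) - v (c + a) + v a + v b + v c = 0 :=
  (QuotientAddGroup.eq_zero_iff _).2 (AddSubgroup.subset_closure (Or.inr ⟨a, b, c, rfl⟩))

theorem v_zero : v (0 : A) = 0 := by
  have h := v_add_add (0 : A) 0 0
  simp only [add_zero] at h
  rw [← h]
  abel

/-- The three-variable relation rearranged: it is exactly additivity of the cross effect of `v` in
one slot. -/
theorem v_add_sub_sub (a b c : A) :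
    v (a + b + c) - v (a + b) - v c = (v (a + c) - v a - v c) + (v (b + c) - v b - v c) := by
  have h := v_add_add a b c
  rw [add_comm c a] at h
  rw [← sub_eq_zero, ← h]
  abel

/-- The biadditive map `A × A → Γ(A)` associated with the quadratic map `v`. -/
def polar : A →+ A →+ Gamma A :=
  AddMonoidHom.mk' (fun a => AddMonoidHom.mk' (fun b => v (a + b) - v a - v b) fun b c => by
      have h := v_add_sub_sub b c a
      simp only [add_comm _ a, sub_right_comm _ _ (v a)] at h
      exact h)
    fun a b => AddMonoidHom.ext fun c => v_add_sub_sub a b c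

theorem polar_apply (a b : A) : polar a b = v (a + b) - v a - v b := rfl

theorem v_add (a b : A) : v (a + b) = v a + v b + polar a b := by
  rw [polar_apply]; abel

theorem polar_comm (a b : A) : polar a b = polar b a := by
  rw [polar_apply, polar_apply, add_comm a b]; abel

/-- Expanding `polar a (-a)` with `v 0 = 0` and `v (-a) = v a` gives `-2 v a`; biadditivity removes
the sign. -/
theorem polar_self (a : A) : polar a a = (2 : ℤ) • v a := by
  have h : polar a (-a) = -((2 : ℤ) • v a) := by
    rw [polar_apply, add_neg_cancel, v_zero, v_neg, two_smul]; abel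
  rwa [map_neg, neg_inj] at h

/-- The homomorphism on `Γ(A)` with `v a ↦ B(a, a)`, for a biadditive map `B`. -/
def quadraticLift (B : A →+ A →+ C) : Gamma A →+ C :=
  QuotientAddGroup.lift _ (FreeAbelianGroup.lift fun a => B a a) <| by
    rw [AddSubgroup.closure_le]
    rintro t (⟨a, rfl⟩ | ⟨a, b, c, rfl⟩)
    · simp
    · simp only [SetLike.mem_coe, AddMonoidHom.mem_ker, map_add, map_sub,
        FreeAbelianGroup.lift_apply_of, AddMonoidHom.add_apply]
      abel

theorem quadraticLift_v (B : A →+ A →+ C) (a : A) : quadraticLift B (v a) = B a a :=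
  FreeAbelianGroup.lift_apply_of _ _

theorem quadraticLift_polar (B : A →+ A →+ C) (a b : A) :
    quadraticLift B (polar a b) = B a b + B b a := by
  rw [polar_apply, map_sub, map_sub, quadraticLift_v, quadraticLift_v, quadraticLift_v]
  simp only [map_add, AddMonoidHom.add_apply]
  abel

section Module

variable {G M N : Type*} [Group G] [AddCommGroup M] [Module (MonoidAlgebra ℤ G) M]
  [AddCommGroup N] [Module (MonoidAlgebra ℤ G) N]

theorem of_smul_polar (g : G) (a b : M) :
    MonoidAlgebra.of ℤ G g • (polar a b : Gamma M) =
      polar (MonoidAlgebra.of ℤ G g • a) (MonoidAlgebra.of ℤ G g • b) := by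
  simp only [polar_apply, smul_sub, of_smul_v, smul_add]

theorem map_of_smul (f : M →ₗ[MonoidAlgebra ℤ G] N) (g : G) (y : Gamma M) :
    map f.toAddMonoidHom (MonoidAlgebra.of ℤ G g • y) =
      MonoidAlgebra.of ℤ G g • map f.toAddMonoidHom y := by
  have : (map f.toAddMonoidHom).comp
        (DistribSMul.toAddMonoidHom (Gamma M) (MonoidAlgebra.of ℤ G g)) =
      (DistribSMul.toAddMonoidHom (Gamma N) (MonoidAlgebra.of ℤ G g)).comp
        (map f.toAddMonoidHom) := by
    refine hom_ext fun a => ?_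
    change map f.toAddMonoidHom (MonoidAlgebra.of ℤ G g • (v a : Gamma M)) =
      MonoidAlgebra.of ℤ G g • map f.toAddMonoidHom (v a)
    rw [of_smul_v, map_v, map_v, of_smul_v]
    exact congrArg v (f.map_smul _ a)
  exact DFunLike.congr_fun this y

end Module

end Gamma

/-! ### `ℤ^w ⊗ B` as the `w`-twisted coinvariants of `B` -/

namespace BalancedTensor

variable {G B C : Type*} [Group G] (w : G →* ℤˣ) [AddCommGroup B] [Module (MonoidAlgebra ℤ G) B]
  [AddCommGroup C]

/-- The homomorphism `b ↦ 1 ⊗ b` from `B` to `ℤ^w ⊗ B`. -/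
def unit : B →+ BalancedTensor (MonoidAlgebra ℤ G) (TwistedInt w) B :=
  (QuotientAddGroup.mk' _).comp
    ((TensorProduct.mk ℤ (TwistedInt w) B (TwistedInt.one w)).toAddMonoidHom)

theorem tmul_eq (z : ℤ) (b : B) :
    tmul (MonoidAlgebra ℤ G) (z • TwistedInt.one w) b = z • unit w b :=
  congrArg (QuotientAddGroup.mk' _) (TensorProduct.smul_tmul' z (TwistedInt.one w) b).symm

theorem zsmul_one (z : TwistedInt w) : (show ℤ from z) • TwistedInt.one w = z :=
  mul_one (show ℤ from z)

/-- `ℤ^w` is generated by `1` as an abelian group, so every pure tensor can be rewritten as `1 ⊗ b`.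
-/
theorem unit_surjective : Function.Surjective (unit (B := B) w) := by
  intro t
  obtain ⟨t, rfl⟩ := QuotientAddGroup.mk_surjective t
  induction t using TensorProduct.induction_on with
  | zero => exact ⟨0, map_zero _⟩
  | tmul z b =>
    refine ⟨(show ℤ from z) • b, ?_⟩
    rw [map_zsmul, ← tmul_eq, zsmul_one]
    rfl
  | add s t hs ht =>
    obtain ⟨a, ha⟩ := hs
    obtain ⟨b, hb⟩ := ht
    exact ⟨a + b, by rw [map_add, ha, hb]; rfl⟩

theorem unit_of_smul (g : G) (b : B) :
    unit w (MonoidAlgebra.of ℤ G g • b) = ((w g : ℤˣ) : ℤ) • unit w b := by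
  rw [← tmul_eq, ← TwistedInt.op_of_smul]
  refine ((QuotientAddGroup.eq_iff_sub_mem).2 (AddSubgroup.subset_closure ?_)).symm
  exact ⟨TwistedInt.one w, MonoidAlgebra.of ℤ G g, b, rfl⟩

/-- The homomorphism on `ℤ^w ⊗ B` induced by a homomorphism on `B` that is equivariant up to `w`. -/
def twistedLift (f : B →+ C)
    (hf : ∀ (g : G) (b : B), f (MonoidAlgebra.of ℤ G g • b) = ((w g : ℤˣ) : ℤ) • f b) :
    BalancedTensor (MonoidAlgebra ℤ G) (TwistedInt w) B →+ C :=
  QuotientAddGroup.lift _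
    (TensorProduct.liftAddHom
      ((AddMonoidHom.mk' (fun z : TwistedInt w => (show ℤ from z) • f)
        fun a b => add_smul (show ℤ from a) (show ℤ from b) f)) fun n z b => by
        change (show ℤ from n • z) • f b = (show ℤ from z) • f (n • b)
        rw [map_zsmul, smul_smul]
        exact congrArg (· • f b) (mul_comm n (show ℤ from z))) <| by
    rw [AddSubgroup.closure_le]
    rintro t ⟨z, r, b, rfl⟩
    -- Equivariance is assumed only for group elements; additivity carries it to the whole group
    -- ring, with the augmentation in place of `w`.
    have key : f (r • b) = TwistedInt.augmentation w r • f b := by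
      induction r using MonoidAlgebra.induction_on with
      | of g =>
        have h : TwistedInt.augmentation w (MonoidAlgebra.of ℤ G g) = ((w g : ℤˣ) : ℤ) :=
          MonoidAlgebra.lift_of _ g
        rw [hf, h]
      | add r s hr hs => rw [add_smul, map_add, hr, hs, map_add, add_smul]
      | smul n r hr => rw [smul_assoc, map_zsmul, hr, map_zsmul, smul_assoc]
    rw [SetLike.mem_coe, AddMonoidHom.mem_ker, map_sub, sub_eq_zero]
    change (show ℤ from MulOpposite.op r • z) • f b = (show ℤ from z) • f (r • b)
    rw [key, smul_smul]
    exact congrArg (· • f b) (mul_comm (TwistedInt.augmentation w r) (show ℤ from z))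

theorem twistedLift_unit (f : B →+ C)
    (hf : ∀ (g : G) (b : B), f (MonoidAlgebra.of ℤ G g • b) = ((w g : ℤˣ) : ℤ) • f b) (b : B) :
    twistedLift w f hf (unit w b) = f b :=
  one_zsmul (f b)

end BalancedTensor

/-! ### The torsion of `ℤ^w ⊗ Γ(ℤ[G])` -/

namespace GroupRingGamma

open BalancedTensor Gamma MonoidAlgebra

variable {G : Type*} [Group G] (w : G →* ℤˣ)

/-- The group `ℤ^w ⊗ Γ(ℤ[G])`. -/
abbrev TwistedGamma : Type _ :=
  BalancedTensor (MonoidAlgebra ℤ G) (TwistedInt w) (Gamma (MonoidAlgebra ℤ G))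

/-- The elements of order two on which `w` is `-1`. -/
abbrev OddInvolution : Type _ := {g : G // g ^ 2 = 1 ∧ w g = -1}

theorem sign_mul_self (g : G) : ((w g : ℤˣ) : ℤ) * ((w g : ℤˣ) : ℤ) = 1 := by
  rw [← Units.val_mul, Int.units_mul_self, Units.val_one]

/-- Since the elements `v a` generate `Γ`, equivariance of `B` on the diagonal suffices. This
matters for `parityForm`, where some translations interchange the two arguments. -/
theorem quadraticLift_of_smul {C : Type*} [AddCommGroup C]
    (B : MonoidAlgebra ℤ G →+ MonoidAlgebra ℤ G →+ C)
    (hB : ∀ (g : G) (a : MonoidAlgebra ℤ G),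
      B (of ℤ G g * a) (of ℤ G g * a) = ((w g : ℤˣ) : ℤ) • B a a)
    (g : G) (y : Gamma (MonoidAlgebra ℤ G)) :
    quadraticLift B (of ℤ G g • y) = ((w g : ℤˣ) : ℤ) • quadraticLift B y := by
  have : (quadraticLift B).comp (DistribSMul.toAddMonoidHom _ (of ℤ G g)) =
      (DistribSMul.toAddMonoidHom C ((w g : ℤˣ) : ℤ)).comp (quadraticLift B) := by
    refine Gamma.hom_ext fun a => ?_
    change quadraticLift B (of ℤ G g • (v a : Gamma (MonoidAlgebra ℤ G))) =
      ((w g : ℤˣ) : ℤ) • quadraticLift B (v a)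
    rw [of_smul_v, quadraticLift_v, quadraticLift_v, smul_eq_mul, hB]
  exact DFunLike.congr_fun this y

/-- The homomorphism on `ℤ^w ⊗ Γ(ℤ[G])` given by a biadditive map on `ℤ[G]` whose associated
quadratic map is equivariant up to `w`. -/
noncomputable def formLift {C : Type*} [AddCommGroup C]
    (B : MonoidAlgebra ℤ G →+ MonoidAlgebra ℤ G →+ C)
    (hB : ∀ (g : G) (a : MonoidAlgebra ℤ G),
      B (of ℤ G g * a) (of ℤ G g * a) = ((w g : ℤˣ) : ℤ) • B a a) :
    TwistedGamma w →+ C :=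
  twistedLift w (quadraticLift B) (quadraticLift_of_smul w B hB)

section Form

variable {C : Type*} [AddCommGroup C] (B : MonoidAlgebra ℤ G →+ MonoidAlgebra ℤ G →+ C)
    (hB : ∀ (g : G) (a : MonoidAlgebra ℤ G),
      B (of ℤ G g * a) (of ℤ G g * a) = ((w g : ℤˣ) : ℤ) • B a a)

theorem formLift_v (a : MonoidAlgebra ℤ G) : formLift w B hB (unit w (v a)) = B a a := by
  rw [formLift, twistedLift_unit, quadraticLift_v]

theorem formLift_polar (a b : MonoidAlgebra ℤ G) :
    formLift w B hB (unit w (polar a b)) = B a b + B b a := by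
  rw [formLift, twistedLift_unit, quadraticLift_polar]

end Form

/-- The biadditive map `(a, b) ↦ ā b` on `ℤ[G]`, for the involution `ḡ = w(g) g⁻¹`. -/
noncomputable def hermitianForm : MonoidAlgebra ℤ G →+ MonoidAlgebra ℤ G →+ MonoidAlgebra ℤ G :=
  biadditiveExtension fun g h => single (g⁻¹ * h) ((w g : ℤˣ) : ℤ)

theorem hermitianForm_of_mul (g : G) (a b : MonoidAlgebra ℤ G) :
    hermitianForm w (of ℤ G g * a) (of ℤ G g * b) = ((w g : ℤˣ) : ℤ) • hermitianForm w a b := by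
  refine apply_mul_mul_eq_of_single (B' := ((w g : ℤˣ) : ℤ) • hermitianForm w) _ (fun h k => ?_) a b
  rw [AddMonoidHom.smul_apply, AddMonoidHom.smul_apply, of_apply, single_mul_single,
    single_mul_single, one_mul, hermitianForm, biadditiveExtension_single,
    biadditiveExtension_single, smul_single, map_mul, Units.val_mul, smul_eq_mul]
  congr 1
  group

/-- The homomorphism `1 ⊗ v(a) ↦ ā a`. -/
noncomputable def hermitianSquare : TwistedGamma w →+ MonoidAlgebra ℤ G :=
  formLift w (hermitianForm w) fun g a => hermitianForm_of_mul w g a a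

open scoped Classical in
/-- The biadditive map on `ℤ[G]` with `(g, g k) ↦ 1` if `w(g) = 1`, and `(g, h) ↦ 0` otherwise. -/
noncomputable def parityForm (k : G) : MonoidAlgebra ℤ G →+ MonoidAlgebra ℤ G →+ ZMod 2 :=
  biadditiveExtension fun g h => if w g = 1 ∧ h = g * k then 1 else 0

theorem parityForm_of_mul_of_eq_one (k g : G) (hg : w g = 1) (a b : MonoidAlgebra ℤ G) :
    parityForm w k (of ℤ G g * a) (of ℤ G g * b) = parityForm w k a b := by
  refine apply_mul_mul_eq_of_single _ (fun h l => ?_) a b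
  rw [of_apply, single_mul_single, single_mul_single, one_mul, parityForm,
    biadditiveExtension_single, biadditiveExtension_single]
  classical
  exact if_congr (by rw [map_mul, hg, one_mul, mul_assoc, mul_right_inj]) rfl rfl

/-- The condition `w g = 1` selects one of the two orderings of a pair `{g, g k}`, since `w (g k) =
-w g`. Translation by an element with `w = -1` selects the other ordering; as `k * k = 1`, that
swaps the arguments. -/
theorem parityForm_of_mul_of_eq_neg_one {k : G} (hk : k ^ 2 = 1 ∧ w k = -1) (g : G)
    (hg : w g = -1) (a b : MonoidAlgebra ℤ G) :
    parityForm w k (of ℤ G g * a) (of ℤ G g * b) = parityForm w k b a := by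
  refine apply_mul_mul_eq_of_single (B' := (parityForm w k).flip) _ (fun h l => ?_) a b
  rw [AddMonoidHom.flip_apply, of_apply, single_mul_single, single_mul_single, one_mul, parityForm,
    biadditiveExtension_single, biadditiveExtension_single]
  have hkk : k * k = 1 := by rw [← sq, hk.1]
  classical
  refine if_congr ?_ rfl rfl
  rw [map_mul, hg, mul_assoc, mul_right_inj]
  constructor
  · rintro ⟨h1, rfl⟩
    rw [map_mul, hk.2, mul_assoc, hkk, mul_one]
    exact ⟨by rwa [mul_comm], rfl⟩
  · rintro ⟨h1, rfl⟩
    rw [map_mul, hk.2, mul_assoc, hkk, mul_one, h1]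
    exact ⟨by norm_num, rfl⟩

/-- The homomorphism that counts modulo `2` the unordered pairs `{g, g k}` in a quadratic
expression. -/
noncomputable def parity (k : OddInvolution w) : TwistedGamma w →+ ZMod 2 :=
  formLift w (parityForm w k) fun g a => by
    rcases Int.units_eq_one_or (w g) with hg | hg
    · rw [parityForm_of_mul_of_eq_one w _ g hg, hg, Units.val_one, one_smul]
    · rw [parityForm_of_mul_of_eq_neg_one w k.2 g hg, hg, Units.val_neg, Units.val_one, neg_smul,
        one_smul, ZMod.neg_eq_self_mod_two]

/-! ### Generators and their relations -/

/-- The class of `1 ⊗ [1, k]`. -/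
noncomputable def pairClass (k : G) : TwistedGamma w := unit w (polar (single 1 1) (single k 1))

theorem unit_polar_single (g h : G) :
    unit w (polar (single g 1) (single h 1)) = ((w g : ℤˣ) : ℤ) • pairClass w (g⁻¹ * h) := by
  rw [pairClass, ← unit_of_smul, of_smul_polar, smul_eq_mul, smul_eq_mul, of_apply,
    single_mul_single, single_mul_single, mul_one, mul_one, mul_inv_cancel_left]

theorem unit_v_single (g : G) :
    unit w (v (single g 1)) = ((w g : ℤˣ) : ℤ) • unit w (v (single (1 : G) (1 : ℤ))) := by
  rw [← unit_of_smul, of_smul_v, smul_eq_mul, of_apply, single_mul_single, mul_one, mul_one]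

/-- By symmetry `[1, k] = [k, 1]`, and translating by `k⁻¹` turns this into `w(k)` times the class
of `k⁻¹`. -/
theorem pairClass_inv (k : G) : pairClass w k⁻¹ = ((w k : ℤˣ) : ℤ) • pairClass w k := by
  have h := unit_polar_single w k 1
  rw [polar_comm, mul_one] at h
  change pairClass w k = _ at h
  rw [h, smul_smul, sign_mul_self, one_smul]

/-- This is why `generator` takes `v(1)` at the index `1`: the pair class there is only its double.
-/
theorem pairClass_one : pairClass w 1 = (2 : ℤ) • unit w (v (single (1 : G) (1 : ℤ))) := by
  rw [pairClass, polar_self, map_zsmul]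

/-- Here `k⁻¹ = k` and `w k = -1`, so `pairClass_inv` says that the class equals its own negative.
-/
theorem two_smul_pairClass (k : OddInvolution w) : (2 : ℤ) • pairClass w (k : G) = 0 := by
  have h := pairClass_inv w (k : G)
  have hk : (k : G)⁻¹ = k := inv_eq_of_mul_eq_one_left (by rw [← sq, k.2.1])
  rw [hk, k.2.2, Units.val_neg, Units.val_one, neg_smul, one_smul] at h
  rw [two_smul]
  nth_rewrite 1 [h]
  exact neg_add_cancel _

open scoped Classical in
theorem parity_pairClass (k l : OddInvolution w) :
    parity w k (pairClass w (l : G)) = if k = l then 1 else 0 := by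
  -- Of the two orderings of the pair, the one starting at `l` contributes nothing because `w l =
  -- -1`.
  rw [pairClass, parity, formLift_polar, parityForm, biadditiveExtension_single,
    biadditiveExtension_single, if_neg (c := w (l : G) = 1 ∧ _), add_zero]
  · simp [Subtype.ext_iff, eq_comm]
  · rw [l.2.2]; rintro ⟨h, -⟩; revert h; decide

open scoped Classical in
/-- Generators of `ℤ^w ⊗ Γ(ℤ[G])`: the class `1 ⊗ v(1)` for `k = 1`, and `1 ⊗ [1, k]` for
`k ≠ 1`. -/
noncomputable def generator (k : G) : TwistedGamma w :=
  if k = 1 then unit w (v (single (1 : G) (1 : ℤ))) else pairClass w k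

theorem generator_one : generator w 1 = unit w (v (single (1 : G) (1 : ℤ))) := if_pos rfl

theorem generator_of_ne {k : G} (hk : k ≠ 1) : generator w k = pairClass w k := if_neg hk

theorem OddInvolution.ne_one (k : OddInvolution w) : (k : G) ≠ 1 := by
  intro h
  have := k.2.2
  rw [h, map_one] at this
  exact absurd this (by decide)

/-- The homomorphism `ℤ[G] → ℤ^w ⊗ Γ(ℤ[G])` given by the generators. -/
noncomputable def presentation : MonoidAlgebra ℤ G →+ TwistedGamma w := additiveExtension (generator w)

theorem presentation_single (k : G) (n : ℤ) : presentation w (single k n) = n • generator w k :=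
  additiveExtension_single _ _ _

theorem generator_mem_range (k : G) : generator w k ∈ (presentation w).range :=
  ⟨single k 1, by rw [presentation_single, one_smul]⟩

theorem pairClass_mem_range (k : G) : pairClass w k ∈ (presentation w).range := by
  by_cases hk : k = 1
  · rw [hk, pairClass_one, ← generator_one]
    exact zsmul_mem (generator_mem_range w 1) 2
  · rw [← generator_of_ne w hk]
    exact generator_mem_range w k

theorem unit_polar_mem_range (a b : MonoidAlgebra ℤ G) :
    unit w (polar a b) ∈ (presentation w).range := by
  rw [← QuotientAddGroup.eq_zero_iff]
  have : (AddMonoidHom.compHom ((QuotientAddGroup.mk' (presentation w).range).comp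
      (unit w))).comp polar = 0 := by
    refine int_hom_ext₂ fun g h => ?_
    refine (QuotientAddGroup.eq_zero_iff _).2 ?_
    rw [unit_polar_single]
    exact zsmul_mem (pairClass_mem_range w _) _
  exact DFunLike.congr_fun (DFunLike.congr_fun this a) b

theorem unit_v_mem_range (a : MonoidAlgebra ℤ G) : unit w (v a) ∈ (presentation w).range := by
  let q := (QuotientAddGroup.mk' (presentation w).range).comp (unit w)
  have hq : ∀ y, q y = 0 ↔ unit w y ∈ (presentation w).range :=
    fun y => QuotientAddGroup.eq_zero_iff _
  -- Modulo the range the polar term vanishes, so `v` becomes additive and is determined by its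
  -- values on group elements.
  let f : MonoidAlgebra ℤ G →+ _ := AddMonoidHom.mk' (fun a => q (v a)) fun a b => by
    rw [v_add, map_add, map_add, (hq _).2 (unit_polar_mem_range w a b), add_zero]
  have hf : f = 0 := int_hom_ext fun g => (hq _).2 <| by
    rw [unit_v_single, ← generator_one]
    exact zsmul_mem (generator_mem_range w 1) _
  exact (hq _).1 (DFunLike.congr_fun hf a)

theorem presentation_surjective : Function.Surjective (presentation w) := by
  rw [← AddMonoidHom.range_eq_top, eq_top_iff]
  rintro t -
  obtain ⟨y, rfl⟩ := unit_surjective w t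
  rw [← QuotientAddGroup.eq_zero_iff]
  have : (QuotientAddGroup.mk' (presentation w).range).comp (unit w) = 0 :=
    Gamma.hom_ext fun a => (QuotientAddGroup.eq_zero_iff _).2 (unit_v_mem_range w a)
  exact DFunLike.congr_fun this y

theorem hermitianSquare_generator_one : hermitianSquare w (generator w 1) = single 1 1 := by
  rw [generator_one, hermitianSquare, formLift_v, hermitianForm, biadditiveExtension_single]
  simp

theorem hermitianSquare_generator {k : G} (hk : k ≠ 1) :
    hermitianSquare w (generator w k) = single k 1 + single k⁻¹ ((w k : ℤˣ) : ℤ) := by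
  rw [generator_of_ne w hk, pairClass, hermitianSquare, formLift_polar, hermitianForm,
    biadditiveExtension_single, biadditiveExtension_single]
  simp

-- Both sides are additive in `x`, and the generator of index `h ≠ 1` maps to `h + w(h) h⁻¹`. The
-- coefficient at `k` therefore only sees the indices `k` and `k⁻¹`.
open scoped Classical in
theorem coeff_hermitianSquare_presentation (x : MonoidAlgebra ℤ G) (k : G) :
    (hermitianSquare w (presentation w x)).coeff k =
      if k = 1 then x.coeff 1 else x.coeff k + ((w k : ℤˣ) : ℤ) * x.coeff k⁻¹ := by
  induction x using MonoidAlgebra.induction_linear with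
  | zero => simp
  | add x y hx hy =>
    rw [map_add, map_add, coeff_add, Finsupp.add_apply, hx, hy]
    simp only [coeff_add, Finsupp.add_apply]
    split_ifs <;> ring
  | single h n =>
    rw [presentation_single, map_zsmul]
    by_cases hh : h = 1
    · subst hh
      rw [hermitianSquare_generator_one]
      by_cases hk : k = 1
      · simp [hk]
      · simp [hk]
    · rw [hermitianSquare_generator w hh]
      by_cases hk : k = 1
      · simp [hk, hh]
      · rw [if_neg hk, smul_add, coeff_add, Finsupp.add_apply, smul_single, smul_single,
          coeff_single, coeff_single, coeff_single, smul_eq_mul, smul_eq_mul, mul_one]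
        congr 1
        rw [Finsupp.single_apply, Finsupp.single_apply]
        by_cases h2 : h = k⁻¹
        · rw [h2, inv_inv, if_pos rfl, if_pos rfl, map_inv, Int.units_inv_eq_self, mul_comm]
        · rw [if_neg h2, if_neg (mt inv_eq_iff_eq_inv.1 h2), mul_zero]

/-! ### Identification of the torsion subgroup -/

/-- The homomorphism that sends the generator of index `k` to `1 ⊗ [1, k]`. -/
noncomputable def involutionClasses : (OddInvolution w →₀ ZMod 2) →+ TwistedGamma w :=
  Finsupp.liftAddHom fun k => ZMod.lift 2
    ⟨zmultiplesHom _ (pairClass w (k : G)), two_smul_pairClass w k⟩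

theorem involutionClasses_single (k : OddInvolution w) :
    involutionClasses w (Finsupp.single k 1) = pairClass w (k : G) := by
  refine (Finsupp.liftAddHom_apply_single _ _ _).trans ?_
  refine (ZMod.lift_coe 2 _ 1).trans (one_zsmul _)

/-- Checked on single terms, where it is the orthogonality of `parity_pairClass`. The parities thus
recover every coordinate of `c`, which gives injectivity. -/
theorem parity_involutionClasses (k : OddInvolution w) (c : OddInvolution w →₀ ZMod 2) :
    parity w k (involutionClasses w c) = c k := by
  classical
  have : (parity w k).comp (involutionClasses w) = Finsupp.applyAddHom k := by
    refine Finsupp.addHom_ext fun l n => ?_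
    obtain ⟨m, rfl⟩ := ZMod.natCast_zmod_surjective n
    rw [← nsmul_one, ← Finsupp.smul_single, map_nsmul, map_nsmul, AddMonoidHom.comp_apply,
      involutionClasses_single, parity_pairClass, Finsupp.applyAddHom_apply, Finsupp.single_apply]
    simp only [eq_comm]
  exact DFunLike.congr_fun this c

theorem involutionClasses_injective : Function.Injective (involutionClasses w) := fun c d h =>
  Finsupp.ext fun k => by rw [← parity_involutionClasses, h, parity_involutionClasses]

theorem two_nsmul_involutionClasses (c : OddInvolution w →₀ ZMod 2) :
    2 • involutionClasses w c = 0 := by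
  rw [← map_nsmul]
  convert map_zero (involutionClasses w)
  ext k
  rw [Finsupp.smul_apply, two_nsmul, CharTwo.add_self_eq_zero, Finsupp.zero_apply]

theorem hermitianSquare_eq_zero_of_mem_torsion {t : TwistedGamma w}
    (ht : t ∈ AddCommGroup.torsion (TwistedGamma w)) : hermitianSquare w t = 0 := by
  obtain ⟨n, hn, h⟩ := isOfFinAddOrder_iff_nsmul_eq_zero.1 ht
  have h' := congrArg (hermitianSquare w) h
  rw [map_nsmul, map_zero] at h'
  refine MonoidAlgebra.ext (Finsupp.ext fun k => ?_)
  have hk := congrArg (fun a : MonoidAlgebra ℤ G => a.coeff k) h'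
  rw [← natCast_zsmul] at hk
  change (n : ℤ) * _ = 0 at hk
  exact (mul_eq_zero.1 hk).resolve_left (by exact_mod_cast hn.ne')

/-- The vanishing Hermitian square gives `x₁ = 0` and `x_k = -w(k) x_{k⁻¹}`. As the generators
satisfy the same symmetry without the minus sign, the terms of `k` and `k⁻¹` cancel unless `k` is an
odd involution. -/
theorem mem_range_of_mem_torsion {t : TwistedGamma w}
    (ht : t ∈ AddCommGroup.torsion (TwistedGamma w)) : t ∈ (involutionClasses w).range := by
  classical
  obtain ⟨x, rfl⟩ := presentation_surjective w t
  have hx := hermitianSquare_eq_zero_of_mem_torsion w ht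
  have hx1 : x.coeff 1 = 0 := by
    have := coeff_hermitianSquare_presentation w x 1
    rwa [hx, if_pos rfl, coeff_zero, Finsupp.zero_apply, eq_comm] at this
  have hxk : ∀ k, x.coeff k = -(((w k : ℤˣ) : ℤ) * x.coeff k⁻¹) := by
    intro k
    by_cases hk : k = 1
    · simp [hk, hx1]
    · have := coeff_hermitianSquare_presentation w x k
      rw [hx, if_neg hk, coeff_zero, Finsupp.zero_apply] at this
      linarith
  have hne : ∀ k, x.coeff k ≠ 0 → k ≠ 1 := fun k hk h => hk (h ▸ hx1)
  -- Odd involutions give terms in the range; the remaining terms must sum to zero.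
  rw [presentation, additiveExtension_apply, ← Finset.sum_filter_add_sum_filter_not
    x.coeff.support (fun k => k ^ 2 = 1 ∧ w k = -1)]
  refine add_mem (sum_mem fun k hk => zsmul_mem ?_ _) ?_
  · have hk' := (Finset.mem_filter.1 hk).2
    exact ⟨Finsupp.single ⟨k, hk'⟩ 1, by
      rw [involutionClasses_single, generator_of_ne w (OddInvolution.ne_one w ⟨k, hk'⟩)]⟩
  · suffices h : ∑ k ∈ x.coeff.support with ¬(k ^ 2 = 1 ∧ w k = -1),
        x.coeff k • generator w k = 0 by
      rw [h]
      exact zero_mem _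
    refine Finset.sum_involution (fun k _ => k⁻¹) ?_ ?_ ?_ fun k _ => inv_inv k
    · intro k hk
      have hk1 := hne k (Finsupp.mem_support_iff.1 (Finset.mem_filter.1 hk).1)
      rw [generator_of_ne w hk1, generator_of_ne w (inv_ne_one.2 hk1), pairClass_inv, smul_smul,
        ← add_smul, hxk k, mul_comm, neg_add_cancel, zero_smul]
    -- A fixed point of inversion has `k² = 1`. If `w k = 1`, then `x_k = -x_k` forces `x_k = 0`; if
    -- `w k = -1`, then `k` was filtered out.
    · intro k hk h0 hkk
      have hk0 : x.coeff k ≠ 0 := Finsupp.mem_support_iff.1 (Finset.mem_filter.1 hk).1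
      have hk2 : k ^ 2 = 1 := by rw [sq]; nth_rewrite 1 [← hkk]; exact inv_mul_cancel k
      rcases Int.units_eq_one_or (w k) with h | h
      · have := hxk k
        rw [hkk, h, Units.val_one, one_mul] at this
        exact hk0 (by linarith)
      · exact (Finset.mem_filter.1 hk).2 ⟨hk2, h⟩
    · intro k hk
      obtain ⟨h1, h2⟩ := Finset.mem_filter.1 hk
      refine Finset.mem_filter.2 ⟨Finsupp.mem_support_iff.2 fun h => ?_, ?_⟩
      · exact Finsupp.mem_support_iff.1 h1 (by rw [hxk, h, mul_zero, neg_zero])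
      · rwa [inv_pow, inv_eq_one, map_inv, Int.units_inv_eq_self]

/-- The torsion subgroup of `ℤ^w ⊗ Γ(ℤ[G])`. -/
theorem torsion_addEquiv :
    Nonempty (AddCommGroup.torsion (TwistedGamma w) ≃+ (OddInvolution w →₀ ZMod 2)) := by
  let f := (involutionClasses w).codRestrict (AddCommGroup.torsion (TwistedGamma w)) fun c =>
    isOfFinAddOrder_iff_nsmul_eq_zero.2 ⟨2, two_pos, two_nsmul_involutionClasses w c⟩
  refine ⟨(AddEquiv.ofBijective f ⟨fun c d h => ?_, fun t => ?_⟩).symm⟩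
  · exact involutionClasses_injective w (congrArg Subtype.val h)
  · obtain ⟨c, hc⟩ := mem_range_of_mem_torsion w t.2
    exact ⟨c, Subtype.ext hc⟩

end GroupRingGamma

/-! ### Functoriality and modules with a free summand -/

namespace BalancedTensor

variable {G M N : Type*} [Group G] (w : G →* ℤˣ) [AddCommGroup M] [Module (MonoidAlgebra ℤ G) M]
  [AddCommGroup N] [Module (MonoidAlgebra ℤ G) N]

/-- The homomorphism `ℤ^w ⊗ Γ(M) → ℤ^w ⊗ Γ(N)` induced by a homomorphism of modules. -/
noncomputable def gammaMap (f : M →ₗ[MonoidAlgebra ℤ G] N) :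
    BalancedTensor (MonoidAlgebra ℤ G) (TwistedInt w) (Gamma M) →+
      BalancedTensor (MonoidAlgebra ℤ G) (TwistedInt w) (Gamma N) :=
  twistedLift w ((unit w).comp (Gamma.map f.toAddMonoidHom)) fun g b => by
    rw [AddMonoidHom.comp_apply, Gamma.map_of_smul, unit_of_smul, AddMonoidHom.comp_apply]

theorem gammaMap_gammaMap (f : M →ₗ[MonoidAlgebra ℤ G] N) (p : N →ₗ[MonoidAlgebra ℤ G] M)
    (h : p ∘ₗ f = LinearMap.id)
    (t : BalancedTensor (MonoidAlgebra ℤ G) (TwistedInt w) (Gamma M)) :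
    gammaMap w p (gammaMap w f t) = t := by
  obtain ⟨y, rfl⟩ := unit_surjective w t
  rw [gammaMap, gammaMap, twistedLift_unit, AddMonoidHom.comp_apply, twistedLift_unit,
    AddMonoidHom.comp_apply, ← AddMonoidHom.comp_apply (Gamma.map _), ← Gamma.map_comp]
  have : p.toAddMonoidHom.comp f.toAddMonoidHom = AddMonoidHom.id M :=
    AddMonoidHom.ext fun m => LinearMap.congr_fun h m
  rw [this, Gamma.map_id, AddMonoidHom.id_apply]

end BalancedTensor

/-- A module that splits off a non-zero free module has the ring as a retract. -/
theorem SplitsOffFree.exists_retract {R M : Type*} [Ring R] [AddCommGroup M] [Module R M]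
    (h : SplitsOffFree R M) : ∃ (i : R →ₗ[R] M) (p : M →ₗ[R] R), p ∘ₗ i = LinearMap.id := by
  obtain ⟨F, N, hFN, hfree, hF⟩ := h
  have : Nontrivial F := Submodule.nontrivial_iff_ne_bot.2 hF
  have : Nontrivial R := Module.nontrivial R F
  let b := Module.Free.chooseBasis R F
  obtain ⟨j⟩ := b.index_nonempty
  -- Include `R` along one basis vector of `F`; return by projecting along `N` and taking that
  -- coordinate.
  refine ⟨F.subtype ∘ₗ LinearMap.toSpanSingleton R F (b j),
    b.coord j ∘ₗ F.projectionOnto N hFN, ?_⟩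
  ext
  simp

/-- If `w` is `-1` on some element of order two, then `ℤ^w ⊗ Γ(M)` has torsion for every module `M`
that splits off a non-zero free module. -/
theorem torsion_gamma_ne_bot {G M : Type*} [Group G] (w : G →* ℤˣ) [AddCommGroup M]
    [Module (MonoidAlgebra ℤ G) M] (hM : SplitsOffFree (MonoidAlgebra ℤ G) M)
    (hg : ∃ g : G, g ^ 2 = 1 ∧ w g = -1) :
    AddCommGroup.torsion
      (BalancedTensor (MonoidAlgebra ℤ G) (TwistedInt w) (Gamma M)) ≠ ⊥ := by
  obtain ⟨g, hg⟩ := hg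
  obtain ⟨i, p, hip⟩ := hM.exists_retract
  let k : GroupRingGamma.OddInvolution w := ⟨g, hg⟩
  intro hbot
  have hmem : BalancedTensor.gammaMap w i (GroupRingGamma.pairClass w g) ∈
      AddCommGroup.torsion (BalancedTensor (MonoidAlgebra ℤ G) (TwistedInt w) (Gamma M)) := by
    refine isOfFinAddOrder_iff_zsmul_eq_zero.2 ⟨2, two_ne_zero, ?_⟩
    rw [← map_zsmul, GroupRingGamma.two_smul_pairClass w k, map_zero]
  rw [hbot, AddSubgroup.mem_bot] at hmem
  -- If the image of the class in `ℤ^w ⊗ Γ(M)` were zero, retracting would make the class itself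
  -- zero, but its parity is `1`.
  have h0 := BalancedTensor.gammaMap_gammaMap w i p hip (GroupRingGamma.pairClass w g)
  rw [hmem, map_zero] at h0
  have h1 := GroupRingGamma.parity_pairClass w k k
  rw [← h0, map_zero, if_pos rfl] at h1
  exact zero_ne_one h1

theorem proposition1p6 :
    (∀ (X : Type*) [TopologicalSpace X] (x : X) (w : FundamentalGroup X x →* ℤˣ),
      IsPoincareComplex 4 X x w →
      SplitsOffFree (MonoidAlgebra ℤ (FundamentalGroup X x)) (PiTwo X x) →
      (∃ g : FundamentalGroup X x, g ^ 2 = 1 ∧ w g = -1) →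
      AddCommGroup.torsion (BalancedTensor (MonoidAlgebra ℤ (FundamentalGroup X x))
        (TwistedInt w) (Gamma (PiTwo X x))) ≠ ⊥) ∧
    (∀ (G : Type*) [Group G] (w : G →* ℤˣ),
      Nonempty (AddCommGroup.torsion (BalancedTensor (MonoidAlgebra ℤ G)
        (TwistedInt w) (Gamma (MonoidAlgebra ℤ G))) ≃+
          ({g : G // g ^ 2 = 1 ∧ w g = -1} →₀ ZMod 2))) :=
  ⟨fun _ _ _ w _ hM hg => torsion_gamma_ne_bot w hM hg,
    fun _ _ w => GroupRingGamma.torsion_addEquiv w⟩
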